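/- Let $G$ be a finite group of even order and let $t$ be an involution of $G$ (an element of order $2$). Let $N$ be a non-trivial nilpotent subgroup of $G$, and suppose that $|C_G(x)|^3 < |G|$ for every non-identity element $x \in N$, where $C_G(x)$ denotes the centralizer of $x$ in $G$. Write $Z(N)$ for the center of $N$. Then: (i) if $N$ is Abelian, then $|N| < \sqrt{2}\,|C_G(t)|$; (ii) if $N$ is non-Abelian, then $$|N| < \sqrt{\frac{2|Z(N)|-1}{|Z(N)|-1}}\;|C_G(t)|.$$ -/

import Mathlib

/-! Both bounds follow from `8 * |N| ≤ 11 * |C(t)|`, since `(11/8)² < 2` and the ratio in (ii)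
exceeds 2. The conjugacy class of `t`, of size `|G| / |C(t)|`, is mapped to `G ⧸ N`; were this
injective, `|N| ≤ |C(t)|` would follow. Two distinct conjugates `u`, `v` in one coset give `1 ≠ u⁻¹v
∈ N` inverted by `u`, so collisions are bounded by the involutions inverting each `x ∈ N`, at most
`|C(x)|` of them. With `b` the largest `|C(x)|`, this is at most `|N| * b`, to be compared with `|G|
> b³`; a further constant factor must be gained.

If `N` is non-abelian, the gain is 3/4: either `C(x)` is non-abelian and at most 3/4 of it can be
inverted, or it is abelian and properly contained in the centralizer of a central element of `N`. If
`N` is abelian, either some `C(x)` is larger than `N`, so `2|N| ≤ b`, or every `C(x)` equals `N`,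
and then all collisions lie in a single coset. -/

open Finset in
open scoped Classical in
/-- A map between finite sets with few collisions has a small domain. -/
theorem two_mul_card_le_add_card_collisions {α β : Type*} [Fintype β] (K : Finset α) (f : α → β) :
    2 * #K ≤ 2 * Fintype.card β + #{p ∈ K.offDiag | f p.1 = f p.2} := by
  have h1 : #K = ∑ b : β, #{a ∈ K | f a = b} :=
    card_eq_sum_card_fiberwise fun _ _ => mem_coe.2 (mem_univ _)
  have h2 : #{p ∈ K.offDiag | f p.1 = f p.2} =
      ∑ b : β, #{p ∈ {p ∈ K.offDiag | f p.1 = f p.2} | f p.1 = b} :=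
    card_eq_sum_card_fiberwise fun _ _ => mem_coe.2 (mem_univ _)
  have h3 : 2 * Fintype.card β = ∑ _b : β, 2 := by simp [mul_comm]
  rw [h1, h2, h3, mul_sum, ← sum_add_distrib]
  refine sum_le_sum fun b _ => ?_
  have h4 : {p ∈ {p ∈ K.offDiag | f p.1 = f p.2} | f p.1 = b} =
      ({a ∈ K | f a = b} : Finset α).offDiag := by
    ext ⟨x, y⟩
    simp only [mem_filter, mem_offDiag]
    grind
  -- A fibre of size `k` contributes `k(k-1)` ordered pairs, and `2k ≤ 2 + k(k-1)` because
  -- `(k-1)(k-2) ≥ 0`.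
  rw [h4, offDiag_card]
  generalize #{a ∈ K | f a = b} = k
  obtain _ | _ | k := k
  · simp
  · simp
  · have : (k + 1 + 1) * (k + 1 + 1) - (k + 1 + 1) = (k + 1 + 1) * (k + 1) := by
      rw [Nat.sub_eq_iff_eq_add (by nlinarith)]; ring
    rw [this]
    nlinarith

open Finset in
open scoped Classical in
/-- If all collisions of a map lie over one point, whose fibre has at most `n` elements, then the
map is almost injective. -/
theorem card_add_one_le_of_collisions_over {α β : Type*} [Fintype β] (K : Finset α) (f : α → β)
    (b : β) (n : ℕ) (hb : ∀ u ∈ K, ∀ v ∈ K, u ≠ v → f u = f v → f u = b)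
    (hn : #{a ∈ K | f a = b} ≤ n) : #K + 1 ≤ Fintype.card β + n := by
  have h1 : #{a ∈ K | ¬ f a = b} ≤ #(univ.erase b) := by
    refine card_le_card_of_injOn f (fun a ha => ?_) fun u hu v hv huv => ?_
    · simpa using (mem_filter.1 ha).2
    · by_contra hne
      have hu := mem_filter.1 (mem_coe.1 hu)
      have hv := mem_filter.1 (mem_coe.1 hv)
      exact hu.2 (hb u hu.1 v hv.1 hne huv)
  rw [card_erase_of_mem (mem_univ _), card_univ] at h1
  have h2 : #{a ∈ K | f a = b} + #{a ∈ K | ¬ f a = b} = #K := card_filter_add_card_filter_not _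
  have : 0 < Fintype.card β := Fintype.card_pos_iff.2 ⟨b⟩
  omega

/-! ### Elements of a subgroup inverted by a conjugation -/

namespace Subgroup

theorem two_mul_card_le_of_lt {G : Type*} [Group G] [Finite G] {H K : Subgroup G} (h : H < K) :
    2 * Nat.card H ≤ Nat.card K := by
  obtain ⟨k, hk⟩ := card_dvd_of_le h.le
  have hpos : 0 < Nat.card K := Nat.card_pos
  rcases k with _ | _ | k
  · simp at hk; omega
  · exact absurd (eq_of_le_of_card_ge h.le (by omega)) h.ne
  · rw [hk]; nlinarith [Nat.zero_le (Nat.card H * k)]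

open Finset in
open scoped Classical in
theorem card_filter_mem {G : Type*} [Group G] [Fintype G] (H : Subgroup G) :
    #{h : G | h ∈ H} = Nat.card H := by
  rw [Nat.card_eq_fintype_card, ← Fintype.card_subtype]

open Finset in
open scoped Classical in
/-- Conjugation by an element inverts at most three quarters of the elements of a non-abelian
group. -/
theorem four_mul_card_inverted_le {G : Type*} [Group G] [Fintype G] (H : Subgroup G)
    (hH : ¬ IsMulCommutative H) (u : G) :
    4 * #{h : G | h ∈ H ∧ u * h * u⁻¹ = h⁻¹} ≤ 3 * Nat.card H := by
  set S : Finset G := {h : G | h ∈ H ∧ u * h * u⁻¹ = h⁻¹} with hS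
  by_contra! hlt
  have memS : ∀ h, h ∈ S ↔ h ∈ H ∧ u * h * u⁻¹ = h⁻¹ := fun h => by simp [hS]
  -- If `S` exceeds 3/4 of `H`, then `S` and `s⁻¹S` overlap in more than half of `H`, and the
  -- overlap commutes with `s`.
  have hcentral : ∀ s ∈ S, H ≤ centralizer {s} := by
    intro s hs
    have hsH := ((memS s).1 hs).1
    set T : Finset G := S.image (s⁻¹ * ·) with hT
    have hTc : #T = #S := card_image_of_injective _ (mul_right_injective _)
    have hun : #(S ∪ T) ≤ Nat.card H := by
      rw [← card_filter_mem H]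
      refine card_le_card fun h hh => ?_
      simp only [mem_filter, mem_univ, true_and]
      rcases mem_union.1 hh with hh | hh
      · exact ((memS h).1 hh).1
      · obtain ⟨a, ha, rfl⟩ := mem_image.1 hh
        exact H.mul_mem (H.inv_mem hsH) ((memS a).1 ha).1
    have hint : #(S ∩ T) ≤ Nat.card (H ⊓ centralizer {s} : Subgroup G) := by
      rw [← card_filter_mem]
      refine card_le_card fun h hh => ?_
      obtain ⟨h1, h2⟩ := mem_inter.1 hh
      obtain ⟨a, ha, rfl⟩ := mem_image.1 h2
      obtain ⟨h1H, h1u⟩ := (memS _).1 h1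
      simp only [mem_filter, mem_univ, true_and, mem_inf, mem_centralizer_singleton_iff]
      refine ⟨h1H, ?_⟩
      have hsu := ((memS s).1 hs).2
      have hau := ((memS a).1 ha).2
      have e : u * (s⁻¹ * a) * u⁻¹ = s * a⁻¹ := by
        have : u * (s⁻¹ * a) * u⁻¹ = (u * s * u⁻¹)⁻¹ * (u * a * u⁻¹) := by group
        rw [this, hsu, hau, inv_inv]
      rw [h1u] at e
      have e' : a⁻¹ * s = s * a⁻¹ := by simpa using e
      have : a * s = s * a := by
        calc a * s = a * (s * a⁻¹) * a := by group
          _ = a * (a⁻¹ * s) * a := by rw [e']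
          _ = s * a := by group
      simp [mul_assoc, this]
    have hsum := card_union_add_card_inter S T
    by_contra hnot
    have := two_mul_card_le_of_lt (inf_lt_left.2 hnot)
    omega
  have hZ : H ≤ centralizer (H : Set G) := by
    by_contra hnot
    have h1 := two_mul_card_le_of_lt (inf_lt_left.2 hnot)
    have h2 : #S ≤ Nat.card (H ⊓ centralizer (H : Set G) : Subgroup G) := by
      rw [← card_filter_mem]
      refine card_le_card fun h hh => ?_
      simp only [mem_filter, mem_univ, true_and, mem_inf]
      refine ⟨((memS h).1 hh).1, mem_centralizer_iff.2 fun k hk => ?_⟩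
      exact mem_centralizer_singleton_iff.1 (hcentral h hh hk)
    omega
  exact hH (le_centralizer_iff_isMulCommutative.1 hZ)

/-! ### Involutions inverting a given element -/

open Finset in
open scoped Classical in
/-- The elements of order at most two that invert `x`. -/
noncomputable def invertingInvolutions {G : Type*} [Group G] [Fintype G] (x : G) : Finset G :=
  {u : G | u * u = 1 ∧ u * x * u⁻¹ = x⁻¹}

-- If `u` and `v` both invert `x`, then `u * v` centralizes `x`, and conjugation by `u` sends it to
-- `v * u = (u * v)⁻¹`.
open Finset in
open scoped Classical in
theorem card_invertingInvolutions_le_inverted {G : Type*} [Group G] [Fintype G] {x u : G}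
    (hu : u ∈ invertingInvolutions x) :
    #(invertingInvolutions x) ≤ #{h : G | h ∈ centralizer {x} ∧ u * h * u⁻¹ = h⁻¹} := by
  simp only [invertingInvolutions, mem_filter, mem_univ, true_and] at hu
  refine card_le_card_of_injOn (u * ·) (fun v hv => ?_) (mul_right_injective u).injOn
  simp only [invertingInvolutions, coe_filter, mem_univ, true_and, Set.mem_ofPred_eq] at hv
  simp only [coe_filter, mem_univ, true_and, Set.mem_ofPred_eq, mem_centralizer_singleton_iff]
  have hu' : u⁻¹ = u := inv_eq_of_mul_eq_one_left hu.1
  have hv' : v⁻¹ = v := inv_eq_of_mul_eq_one_left hv.1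
  constructor
  · have h1 : v * x = x⁻¹ * v := by rw [← hv.2]; group
    have h2 : u * x⁻¹ = x * u := by
      have : u * x⁻¹ = (u * x * u⁻¹)⁻¹ * u := by group
      rw [this, hu.2, inv_inv]
    rw [mul_assoc, h1, ← mul_assoc, h2, mul_assoc]
  · rw [mul_inv_rev, hu', hv', ← mul_assoc, hu.1, one_mul]

open Finset in
theorem card_invertingInvolutions_le {G : Type*} [Group G] [Fintype G] (x : G) :
    #(invertingInvolutions x) ≤ Nat.card (centralizer {x}) := by
  classical
  obtain h | ⟨u, hu⟩ := (invertingInvolutions x).eq_empty_or_nonempty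
  · simp [h]
  · refine (card_invertingInvolutions_le_inverted hu).trans ?_
    rw [← card_filter_mem]
    refine card_le_card fun h hh => ?_
    simp only [mem_filter, mem_univ, true_and] at hh ⊢
    exact hh.1

open Finset in
theorem four_mul_card_invertingInvolutions_le {G : Type*} [Group G] [Fintype G] (x : G)
    (hx : ¬ IsMulCommutative (centralizer {x})) :
    4 * #(invertingInvolutions x) ≤ 3 * Nat.card (centralizer {x}) := by
  classical
  obtain h | ⟨u, hu⟩ := (invertingInvolutions x).eq_empty_or_nonempty
  · simp [h]
  · have h1 := card_invertingInvolutions_le_inverted hu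
    have h2 := four_mul_card_inverted_le _ hx u
    convert (Nat.mul_le_mul_left 4 h1).trans h2

/-! ### Collisions of involutions modulo `N` -/

open Finset in
open scoped Classical in
/-- Pairs of distinct involutions in the same left coset of `N` have as product a non-trivial
element of `N` that is inverted by both of them. -/
theorem card_collisions_le_sum {G : Type*} [Group G] [Fintype G] (N : Subgroup G)
    (K : Finset G) (hK : ∀ u ∈ K, u * u = 1) :
    #{p ∈ K.offDiag | (p.1 : G ⧸ N) = p.2} ≤
      ∑ x ∈ ({x : G | x ∈ N} : Finset G).erase 1, #(invertingInvolutions x) := by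
  rw [← card_sigma]
  refine card_le_card_of_injOn (fun p => ⟨p.1⁻¹ * p.2, p.1⟩) ?_ ?_
  · rintro ⟨u, v⟩ h
    simp only [coe_filter, mem_offDiag, Set.mem_ofPred_eq, QuotientGroup.eq] at h
    obtain ⟨⟨hu, hv, hne⟩, hN⟩ := h
    have hu' : u⁻¹ = u := inv_eq_of_mul_eq_one_left (hK u hu)
    have hv' : v⁻¹ = v := inv_eq_of_mul_eq_one_left (hK v hv)
    simp only [coe_sigma, Set.mem_sigma_iff, mem_coe, mem_erase, mem_filter, mem_univ, true_and,
      invertingInvolutions]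
    refine ⟨⟨fun h => hne (inv_mul_eq_one.1 h), hN⟩, hK u hu, ?_⟩
    rw [mul_inv_rev, inv_inv, hv']
    rw [hu', ← mul_assoc, hK u hu, one_mul]
  · rintro ⟨u, v⟩ - ⟨u', v'⟩ - h
    simp only [Sigma.mk.injEq, heq_eq_eq] at h
    obtain ⟨h1, rfl⟩ := h
    simpa using h1

open Finset in
open scoped Classical in
theorem card_conjugates_mul_card_centralizer {G : Type*} [Group G] [Fintype G] (t : G) :
    #{u : G | IsConj t u} * Nat.card (centralizer {t}) = Nat.card G := by
  have h := MulAction.card_orbit_mul_card_stabilizer_eq_card_group (ConjAct G) t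
  rw [ConjAct.card, ← Nat.card_eq_fintype_card (α := G),
    ← Nat.card_eq_fintype_card (α := MulAction.stabilizer (ConjAct G) t),
    ← nat_card_centralizer_nat_card_stabilizer] at h
  rw [← h, ← Set.toFinset_card]
  congr 2
  ext u
  rw [mem_filter, Set.mem_toFinset, ConjAct.mem_orbit_conjAct, isConj_comm]
  simp

theorem mul_self_eq_one_of_isConj {G : Type*} [Group G] {t u : G} (ht : t * t = 1)
    (h : IsConj t u) : u * u = 1 := by
  obtain ⟨c, rfl⟩ := isConj_iff.1 h
  rw [conj_mul, ht, mul_one, mul_inv_cancel]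

-- The collision bound `2k ≤ 2[G : N] + S`, multiplied by `4 |N| |C(t)|`, where `k |C(t)| = |G|`.
open Finset in
open scoped Classical in
theorem eight_mul_card_le_of_sum_invertingInvolutions_le {G : Type*} [Group G] [Fintype G] {t : G}
    (ht : t * t = 1) (N : Subgroup G)
    (h : 4 * Nat.card N *
      ∑ x ∈ ({x : G | x ∈ N} : Finset G).erase 1, #(invertingInvolutions x) ≤ 3 * Nat.card G) :
    8 * Nat.card N ≤ 11 * Nat.card (centralizer {t}) := by
  have hK : ∀ u ∈ ({u : G | IsConj t u} : Finset G), u * u = 1 :=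
    fun u hu => mul_self_eq_one_of_isConj ht (mem_filter.1 hu).2
  have h1 := two_mul_card_le_add_card_collisions ({u : G | IsConj t u} : Finset G)
    (fun u => (u : G ⧸ N))
  have h2 := card_collisions_le_sum N _ hK
  have h3 := card_conjugates_mul_card_centralizer t
  have h4 := N.card_eq_card_quotient_mul_card_subgroup
  rw [Nat.card_eq_fintype_card (α := G ⧸ N)] at h4
  have hg : 0 < Nat.card G := Nat.card_pos
  have h5 : 2 * #({u : G | IsConj t u} : Finset G) ≤ 2 * Fintype.card (G ⧸ N) +
      ∑ x ∈ ({x : G | x ∈ N} : Finset G).erase 1, #(invertingInvolutions x) := by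
    refine h1.trans (Nat.add_le_add_left ?_ _)
    convert h2
  refine Nat.le_of_mul_le_mul_right ?_ hg
  generalize ∑ x ∈ ({x : G | x ∈ N} : Finset G).erase 1, #(invertingInvolutions x) = S at *
  generalize #({u : G | IsConj t u} : Finset G) = k at *
  generalize Fintype.card (G ⧸ N) = q at *
  generalize Nat.card G = g at *
  generalize Nat.card N = n at *
  generalize Nat.card (centralizer {t}) = c at *
  calc 8 * n * g = 4 * n * c * (2 * k) := by rw [← h3]; ring
    _ ≤ 4 * n * c * (2 * q + S) := Nat.mul_le_mul_left _ h5
    _ = c * (8 * (q * n) + 4 * n * S) := by ring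
    _ ≤ c * (8 * g + 3 * g) := by rw [← h4]; gcongr
    _ = 11 * c * g := by ring

open Finset in
open scoped Classical in
theorem sum_ne_one_le_card_mul {G : Type*} [Group G] [Fintype G] (N : Subgroup G) (f : G → ℕ) (b : ℕ)
    (hf : ∀ x ∈ N, x ≠ 1 → f x ≤ b) :
    ∑ x ∈ ({x : G | x ∈ N} : Finset G).erase 1, f x ≤ Nat.card N * b := by
  refine (sum_le_card_nsmul _ _ b fun x hx => ?_).trans ?_
  · simp only [mem_erase, mem_filter, mem_univ, true_and] at hx
    exact hf x hx.2 hx.1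
  · rw [smul_eq_mul, ← card_filter_mem]
    exact Nat.mul_le_mul_right _ (card_le_card (erase_subset _ _))

open Finset in
theorem exists_max_card_centralizer {G : Type*} [Group G] [Finite G] {N : Subgroup G}
    (hN : N ≠ ⊥) : ∃ y ∈ N, y ≠ 1 ∧ ∀ x ∈ N, x ≠ 1 →
      Nat.card (centralizer {x}) ≤ Nat.card (centralizer {y}) := by
  obtain ⟨w, hw, hw1⟩ := N.bot_or_exists_ne_one.resolve_left hN
  obtain ⟨y, ⟨hy, hy1⟩, hmax⟩ := Set.exists_max_image {x : G | x ∈ N ∧ x ≠ 1}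
    (fun x => Nat.card (centralizer {x})) (Set.toFinite _) ⟨w, hw, hw1⟩
  exact ⟨y, hy, hy1, fun x hx hx1 => hmax x ⟨hx, hx1⟩⟩

theorem le_centralizer_singleton_of_isMulCommutative {G : Type*} [Group G] {N : Subgroup G}
    (hN : IsMulCommutative N) {x : G} (hx : x ∈ N) : N ≤ centralizer {x} :=
  fun y hy => mem_centralizer_singleton_iff.2 <|
    (isMulCommutative_iff_of_setLike.1 hN y hy x hx)

theorem exists_ne_one_le_centralizer {G : Type*} [Group G] {N : Subgroup G} (hN : N ≠ ⊥)
    (hnil : Group.IsNilpotent N) : ∃ z ∈ N, z ≠ 1 ∧ N ≤ centralizer {z} := by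
  have : Nontrivial N := (nontrivial_iff_ne_bot N).2 hN
  obtain ⟨z, hz⟩ := (center N).ne_bot_iff_exists_ne_one.1
    (Group.IsNilpotent.center_ne_bot N)
  refine ⟨z, z.1.2, fun h => hz (Subtype.ext (Subtype.ext h)), fun y hy => ?_⟩
  exact mem_centralizer_singleton_iff.2
    (congrArg Subtype.val (mem_center_iff.1 z.2 ⟨y, hy⟩))

/-! ### The non-abelian case -/

theorem eight_mul_card_le_of_not_isMulCommutative {G : Type*} [Group G] [Fintype G] {t : G}
    (ht : t * t = 1) {N : Subgroup G} (hN : N ≠ ⊥) (hnil : Group.IsNilpotent N)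
    (hcent : ∀ x ∈ N, x ≠ 1 → Nat.card (centralizer {x}) ^ 3 < Nat.card G)
    (hcomm : ¬ IsMulCommutative N) :
    8 * Nat.card N ≤ 11 * Nat.card (centralizer {t}) := by
  classical
  obtain ⟨y, hy, hy1, hmax⟩ := exists_max_card_centralizer hN
  obtain ⟨z, hz, hz1, hNz⟩ := exists_ne_one_le_centralizer hN hnil
  have hB := hcent y hy hy1
  have hzB := hmax z hz hz1
  have hn : Nat.card N ≤ Nat.card (centralizer {y}) := (card_le_of_le hNz).trans hzB
  have key : ∀ x ∈ N, x ≠ 1 → 4 * (invertingInvolutions x).card ≤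
      3 * Nat.card (centralizer {y}) := by
    intro x hx hx1
    by_cases hab : IsMulCommutative (centralizer {x})
    -- As `z` lies in the abelian group `C(x)`, `C(x) ≤ C(z)`; equality would put `N` inside `C(x)`
    -- and make it abelian. So `|C(x)| ≤ b/2`.
    · have hzx : z ∈ centralizer {x} :=
        mem_centralizer_singleton_iff.2 (mem_centralizer_singleton_iff.1 (hNz hx)).symm
      have hlt : centralizer {x} < centralizer {z} := by
        refine lt_of_le_of_ne (le_centralizer_singleton_of_isMulCommutative hab hzx) fun h => ?_
        refine hcomm (isMulCommutative_iff_of_setLike.2 fun a ha b hb => ?_)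
        have hNx : N ≤ centralizer {x} := h ▸ hNz
        exact isMulCommutative_iff_of_setLike.1 hab a (hNx ha) b (hNx hb)
      have h1 := two_mul_card_le_of_lt hlt
      have h2 := card_invertingInvolutions_le x
      omega
    · have h1 := four_mul_card_invertingInvolutions_le x hab
      have h2 := hmax x hx hx1
      omega
  refine eight_mul_card_le_of_sum_invertingInvolutions_le ht N ?_
  have h := sum_ne_one_le_card_mul N _ _ key
  rw [← Finset.mul_sum] at h
  generalize Nat.card (centralizer {y}) = b at *
  calc _ = Nat.card N * (4 * ∑ x ∈ ({x : G | x ∈ N} : Finset G).erase 1,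
        (invertingInvolutions x).card) := by ring
    _ ≤ b * (b * (3 * b)) := 
        Nat.mul_le_mul hn (h.trans (Nat.mul_le_mul_right _ hn))
    _ = 3 * b ^ 3 := by ring
    _ ≤ _ := by omega

/-! ### The abelian case -/

/-- If an abelian subgroup `N` is the centralizer of each of its non-trivial elements, then the
involutions inverting some non-trivial element of `N` all lie in the same coset of `N`. -/
theorem inv_mul_mem_of_inverts {G : Type*} [Group G] {N : Subgroup G}
    (hcomm : IsMulCommutative N) (hC : ∀ x ∈ N, x ≠ 1 → centralizer {x} = N) {u v x y : G}
    (hu : u * u = 1) (hv : v * v = 1) (hx : x ∈ N) (hx1 : x ≠ 1) (hy : y ∈ N) (hy1 : y ≠ 1)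
    (hux : u * x * u⁻¹ = x⁻¹) (hvy : v * y * v⁻¹ = y⁻¹) : u⁻¹ * v ∈ N := by
  have comm : ∀ a ∈ N, ∀ b ∈ N, a * b = b * a := isMulCommutative_iff_of_setLike.1 hcomm
  have mem : ∀ w a, a ∈ N → a ≠ 1 → w * a = a * w → w ∈ N := fun w a ha ha1 h => by
    rw [← hC a ha ha1]; exact mem_centralizer_singleton_iff.2 h
  have normal : ∀ w x, w * w = 1 → x ∈ N → x ≠ 1 → w * x * w⁻¹ = x⁻¹ →
      ∀ a ∈ N, w * a * w⁻¹ ∈ N := by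
    intro w x hw hx hx1 hwx a ha
    refine mem _ x⁻¹ (N.inv_mem hx) (by simpa using hx1) ?_
    rw [← hwx]
    have := comm a ha x hx
    calc w * a * w⁻¹ * (w * x * w⁻¹) = w * (a * x) * w⁻¹ := by group
      _ = w * (x * a) * w⁻¹ := by rw [this]
      _ = _ := by group
  -- The element `(w a w⁻¹) a` of `N` commutes with `w`; were it non-trivial, its centralizer `N`
  -- would contain `w`.
  have invert : ∀ w x, w * w = 1 → x ∈ N → x ≠ 1 → w * x * w⁻¹ = x⁻¹ → w ∉ N →
      ∀ a ∈ N, w * a * w⁻¹ = a⁻¹ := by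
    intro w x hw hx hx1 hwx hwN a ha
    have hn := normal w x hw hx hx1 hwx a ha
    have hw' : w⁻¹ = w := inv_eq_of_mul_eq_one_left hw
    by_contra hne
    refine hwN (mem w (w * a * w⁻¹ * a) (N.mul_mem hn ha)
      (fun h => hne (eq_inv_of_mul_eq_one_left h)) ?_)
    calc w * (w * a * w⁻¹ * a) = (w * w) * a * w⁻¹ * a := by group
      _ = a * (w * a * w⁻¹) * w := by rw [hw, hw']; simp [mul_assoc, hw]
      _ = w * a * w⁻¹ * a * w := by rw [comm a ha _ hn]
  -- As `w ∈ N` centralizes and inverts `x`, `x = x⁻¹`; a `w'` outside `N` would invert `x`, hence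
  -- centralize it.
  have mem_of_mem : ∀ w w' x y, w * w = 1 → w ∈ N → w' * w' = 1 → x ∈ N → x ≠ 1 → y ∈ N → y ≠ 1 →
      w * x * w⁻¹ = x⁻¹ → w' * y * w'⁻¹ = y⁻¹ → w' ∈ N := by
    intro w w' x y hw hwN hw' hx hx1 hy hy1 hwx hwy
    by_contra hw'N
    have h := invert w' y hw' hy hy1 hwy hw'N x hx
    rw [← hwx, comm w hwN x hx, mul_inv_cancel_right, mul_inv_eq_iff_eq_mul] at h
    exact hw'N (mem w' x hx hx1 h)
  by_cases huN : u ∈ N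
  · exact N.mul_mem (N.inv_mem huN) (mem_of_mem u v x y hu huN hv hx hx1 hy hy1 hux hvy)
  have hvN : v ∉ N := fun hvN => huN (mem_of_mem v u y x hv hvN hu hy hy1 hx hx1 hvy hux)
  have h1 := invert u x hu hx hx1 hux huN x⁻¹ (N.inv_mem hx)
  have h2 := invert v y hv hy hy1 hvy hvN x hx
  refine mem _ x hx hx1 ?_
  have hu' : u⁻¹ = u := inv_eq_of_mul_eq_one_left hu
  rw [inv_inv, mul_inv_eq_iff_eq_mul] at h1
  rw [mul_inv_eq_iff_eq_mul] at h2
  rw [hu', mul_assoc, h2, ← mul_assoc, h1, mul_assoc]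

open Finset in
open scoped Classical in
theorem card_conjugates_add_one_le {G : Type*} [Group G] [Fintype G] {N : Subgroup G}
    (hcomm : IsMulCommutative N) (hC : ∀ x ∈ N, x ≠ 1 → centralizer {x} = N) (K : Finset G)
    (hK : ∀ u ∈ K, u * u = 1) :
    #K + 1 ≤ Fintype.card (G ⧸ N) + Nat.card N := by
  have inverted : ∀ u ∈ K, ∀ v ∈ K, u ≠ v → (u : G ⧸ N) = v →
      u⁻¹ * v ∈ N ∧ u⁻¹ * v ≠ 1 ∧ u * (u⁻¹ * v) * u⁻¹ = (u⁻¹ * v)⁻¹ := by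
    intro u hu v hv hne h
    have hu' : u⁻¹ = u := inv_eq_of_mul_eq_one_left (hK u hu)
    have hv' : v⁻¹ = v := inv_eq_of_mul_eq_one_left (hK v hv)
    refine ⟨QuotientGroup.eq.1 h, fun h => hne (inv_mul_eq_one.1 h), ?_⟩
    rw [mul_inv_rev, inv_inv, hv', mul_inv_cancel_left, hu']
  have fibre : ∀ w : G, #(K.filter fun a : G => (a : G ⧸ N) = w) ≤ Nat.card N := by
    intro w
    rw [← card_filter_mem]
    refine card_le_card_of_injOn (w⁻¹ * ·) (fun a ha => ?_) (mul_right_injective _).injOn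
    simp only [coe_filter, Set.mem_ofPred_eq, mem_univ, true_and] at ha ⊢
    exact QuotientGroup.eq.1 ha.2.symm
  by_cases hex : ∃ u ∈ K, ∃ v ∈ K, u ≠ v ∧ (u : G ⧸ N) = v
  · obtain ⟨w, hw, w', hw', hne, heq⟩ := hex
    obtain ⟨a1, a2, a3⟩ := inverted w hw w' hw' hne heq
    refine card_add_one_le_of_collisions_over K (fun u => (u : G ⧸ N)) w _
      (fun u hu v hv huv h => ?_) (by convert fibre w)
    obtain ⟨b1, b2, b3⟩ := inverted u hu v hv huv h
    exact QuotientGroup.eq.2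
      (inv_mul_mem_of_inverts hcomm hC (hK u hu) (hK w hw) b1 b2 a1 a2 b3 a3)
  · push Not at hex
    exact card_add_one_le_of_collisions_over K (fun u => (u : G ⧸ N)) (1 : G) _
      (fun u hu v hv huv h => absurd h (hex u hu v hv huv)) (by convert fibre 1)

theorem eight_mul_card_le_of_isMulCommutative {G : Type*} [Group G] [Fintype G] {t : G}
    (ht : t * t = 1) {N : Subgroup G} (hN : N ≠ ⊥)
    (hcent : ∀ x ∈ N, x ≠ 1 → Nat.card (centralizer {x}) ^ 3 < Nat.card G)
    (hcomm : IsMulCommutative N) :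
    8 * Nat.card N ≤ 11 * Nat.card (centralizer {t}) := by
  classical
  obtain ⟨y, hy, hy1, hmax⟩ := exists_max_card_centralizer hN
  have hB := hcent y hy hy1
  by_cases hC : ∀ x ∈ N, x ≠ 1 → centralizer {x} = N
  · rw [hC y hy hy1] at hB
    have h1 := card_conjugates_add_one_le hcomm hC ({u : G | IsConj t u} : Finset G)
      fun u hu => mul_self_eq_one_of_isConj ht (Finset.mem_filter.1 hu).2
    have h3 := card_conjugates_mul_card_centralizer t
    have h4 := N.card_eq_card_quotient_mul_card_subgroup
    rw [Nat.card_eq_fintype_card (α := G ⧸ N)] at h4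
    refine Nat.le_of_mul_le_mul_right ?_ (Nat.card_pos (α := G))
    generalize ({u : G | IsConj t u} : Finset G).card = k at *
    generalize Fintype.card (G ⧸ N) = q at *
    generalize Nat.card G = g at *
    obtain ⟨m, hm⟩ : ∃ m, Nat.card N = m + 1 := Nat.exists_eq_add_one.2 Nat.card_pos
    rw [hm] at hB h1 h4 ⊢
    generalize Nat.card (centralizer {t}) = c at *
    have hk : k ≤ q + m := by omega
    -- Reduces to `8m ≤ 3(m + 1)²`; having `m = |N| - 1` in place of `|N|` is what makes this hold
    -- for all `m`.
    have h5 : 8 * ((m + 1) * m) ≤ 3 * g := by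
      have : 8 * ((m + 1) * m) ≤ 3 * (m + 1) ^ 3 := by
        zify
        nlinarith [sq_nonneg (3 * (m : ℤ) - 1), Int.natCast_nonneg m]
      omega
    calc 8 * (m + 1) * g = 8 * (m + 1) * c * k := by rw [← h3]; ring
      _ ≤ 8 * (m + 1) * c * (q + m) := Nat.mul_le_mul_left _ hk
      _ = c * (8 * (q * (m + 1)) + 8 * ((m + 1) * m)) := by ring
      _ ≤ c * (8 * g + 3 * g) := by rw [← h4]; gcongr
      _ = 11 * c * g := by ring
  · push Not at hC
    obtain ⟨x, hx, hx1, hxN⟩ := hC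
    have h1 := two_mul_card_le_of_lt
      (lt_of_le_of_ne (le_centralizer_singleton_of_isMulCommutative hcomm hx) hxN.symm)
    have h2 := hmax x hx hx1
    refine eight_mul_card_le_of_sum_invertingInvolutions_le ht N ?_
    have h := sum_ne_one_le_card_mul N _ _ fun x hx hx1 =>
      (card_invertingInvolutions_le x).trans (hmax x hx hx1)
    generalize Nat.card (centralizer {y}) = b at *
    -- `|N|` enters the sum bound squared, so this 2 absorbs the factor 4.
    have hn : 2 * Nat.card N ≤ b := h1.trans h2
    calc _ ≤ 4 * Nat.card N * (Nat.card N * b) := Nat.mul_le_mul_left _ h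
      _ = (2 * Nat.card N) * (2 * Nat.card N) * b := by ring
      _ ≤ b * b * b := by gcongr
      _ = b ^ 3 := by ring
      _ ≤ _ := by omega

end Subgroup

theorem lt_sqrt_mul_of_eight_mul_le {n c : ℕ} (hc : 0 < c) (h : 8 * n ≤ 11 * c) {r : ℝ}
    (hr : 2 ≤ r) : (n : ℝ) < Real.sqrt r * c := by
  have h1 : (11 / 8 : ℝ) < Real.sqrt r := Real.lt_sqrt_of_sq_lt (by norm_num; linarith)
  have h2 : (8 * n : ℝ) ≤ 11 * c := by exact_mod_cast h
  have h3 : (0 : ℝ) < c := by exact_mod_cast hc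
  nlinarith

theorem theorem8 {G : Type*} [Group G] [Finite G] (hG : Even (Nat.card G))
    (t : G) (ht : orderOf t = 2)
    (N : Subgroup G) (hN : N ≠ ⊥) (hnil : Group.IsNilpotent N)
    (hcent : ∀ x ∈ N, x ≠ 1 →
      Nat.card (Subgroup.centralizer ({x} : Set G)) ^ 3 < Nat.card G) :
    (IsMulCommutative N →
      (Nat.card N : ℝ) <
        Real.sqrt 2 * (Nat.card (Subgroup.centralizer ({t} : Set G)) : ℝ)) ∧
    (¬ IsMulCommutative N →
      (Nat.card N : ℝ) <
        Real.sqrt ((2 * (Nat.card (Subgroup.center N) : ℝ) - 1) /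
            ((Nat.card (Subgroup.center N) : ℝ) - 1)) *
          (Nat.card (Subgroup.centralizer ({t} : Set G)) : ℝ)) := by
  have := Fintype.ofFinite G
  have ht' : t * t = 1 := by rw [← sq, ← ht, pow_orderOf_eq_one]
  refine ⟨fun hcomm => ?_, fun hcomm => ?_⟩
  · exact lt_sqrt_mul_of_eight_mul_le Nat.card_pos
      (Subgroup.eight_mul_card_le_of_isMulCommutative ht' hN hcent hcomm) le_rfl
  · refine lt_sqrt_mul_of_eight_mul_le Nat.card_pos
      (Subgroup.eight_mul_card_le_of_not_isMulCommutative ht' hN hnil hcent hcomm) ?_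
    have : Nontrivial N := (Subgroup.nontrivial_iff_ne_bot N).2 hN
    have hz : 1 < Nat.card (Subgroup.center N) :=
      (Subgroup.one_lt_card_iff_ne_bot _).2 (Group.IsNilpotent.center_ne_bot N)
    have hz' : (1 : ℝ) < Nat.card (Subgroup.center N) := by exact_mod_cast hz
    rw [le_div_iff₀ (by linarith)]
    linarith
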